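/- Let $q$ be a prime power, $R=\mathbb{F}_q[\theta]$ and $K=\mathbb{F}_q(\theta)$. For a finite Galois extension $L/K$ let $R_L$ be the integral closure of $R$ in $L$. For a monic irreducible $P\in R$, a Frobenius map at a prime ideal $\mathfrak p$ of $R_L$ over $(P)$ is a $\sigma\in\mathrm{Gal}(L/K)$ with $\sigma(x)\equiv x^{\#R/(P)} \bmod \mathfrak p$ for all $x\in R_L$, and the Frobenius class of $P$ is the set of all Frobenius maps at primes $\mathfrak p$ of $R_L$ over $(P)$ (a conjugacy class if $P$ is unramified in $L$). For a union $C$ of conjugacy classes of $\mathrm{Gal}(L/K)$ let $S_{L,C}$ be the set of monic irreducible $P\in R$ whose Frobenius class is contained in $C$. A set $S$ of monic irreducible elements of $R$ is called Frobenian if there are a finite Galois extension $L/K$ and a union $C$ of conjugacy classes of $\mathrm{Gal}(L/K)$ such that $S$ and $S_{L,C}$ differ by only finitely many elements. A linear recurrent sequence over $K$ is a sequence $(a_n)_{n\ge 0}$ in $K$ satisfying $a_{n+l}=c_1a_{n+l-1}+\cdots+c_la_n$ for all $n\ge 0$, for some $l\ge 0$ and $c_1,\dots,c_l\in K$; the eigen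 polynomial of this recurrence is $x^l-c_1x^{l-1}-\cdots-c_l$. It is called separable (for short) if it is a finite product of polynomials in $K[x]$ each of which has no multiple roots in an algebraic closure of $K$. For $a\in K$, the congruence $a\equiv 0 \bmod P$ means that $a=r/s$ for some $r,s\in R$ with $P\mid r$ and $P\nmid s$. **Statement.** A set $S$ of monic irreducible elements of $R$ is Frobenian if and only if there is a linear recurrent sequence $(a_n)_n$ over $K$, satisfying a recurrence with separable eigen polynomial, such that $S$ is a cofinite subset of $Z=\{P \mid a_{q^{\deg P}}\equiv 0 \bmod P\}$, i.e. $S\subseteq Z$ and $Z\setminus S$ is finite. -/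

import Mathlib

open Polynomial

universe u

/-- The monic irreducible elements `P` of `R = F[θ]`. -/
abbrev MonicIrreducible (F : Type u) [Field F] : Type u :=
  {P : F[X] // P.Monic ∧ Irreducible P}

/-- `a ≡ 0 mod P` for an element `a` of `K = F(θ)`: `a` can be written with a numerator divisible
by `P` and a denominator not divisible by `P`, i.e. `a` lies in the maximal ideal of the
localization `R_(P)`. -/
def CongrZeroMod {F : Type u} [Field F] (a : RatFunc F) (P : F[X]) : Prop :=
  ∃ r s : F[X], P ∣ r ∧ ¬ P ∣ s ∧ a = algebraMap F[X] (RatFunc F) r / algebraMap F[X] (RatFunc F) s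

/-- The polynomial `p` is a finite product of separable polynomials. -/
def IsProdOfSeparable {K : Type u} [Field K] (p : K[X]) : Prop :=
  ∃ s : Multiset K[X], (∀ f ∈ s, f.Separable) ∧ s.prod = p

section Frobenius

variable {F : Type u} [Field F]
variable (L : Type u) [Field L] [Algebra F[X] L] [Algebra (RatFunc F) L]
  [IsScalarTower F[X] (RatFunc F) L] [FiniteDimensional (RatFunc F) L]

/-- `σ ∈ Gal(L/K)` is a Frobenius map at the prime `𝔭` of the integral closure `R_L` of `R` in `L`:
`σ x ≡ x ^ #(R / (𝔭 ∩ R)) mod 𝔭` for all `x ∈ R_L`. -/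
def IsFrobeniusMapAt (σ : Gal(L/RatFunc F)) (𝔭 : Ideal (integralClosure F[X] L)) : Prop :=
  (galRestrict F[X] (RatFunc F) L (integralClosure F[X] L) σ).toAlgHom.IsArithFrobAt 𝔭

/-- The Frobenius class of `P` in `Gal(L/K)`: the set of all Frobenius maps at the primes of `R_L`
lying over `(P)`. If `P` is unramified in a Galois extension `L/K`, it is a conjugacy class. -/
def frobeniusClass (P : F[X]) : Set Gal(L/RatFunc F) :=
  {σ | ∃ 𝔭 : Ideal (integralClosure F[X] L),
    𝔭.IsPrime ∧ 𝔭.under F[X] = Ideal.span {P} ∧ IsFrobeniusMapAt L σ 𝔭}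

/-- `S_{L,C}`: the set of all `P` whose Frobenius class is contained in `C`. -/
def hittingSet (C : Set Gal(L/RatFunc F)) : Set (MonicIrreducible F) :=
  {P | frobeniusClass L (P : F[X]) ⊆ C}

end Frobenius

/-- `C` is a union of conjugacy classes of the group `G`. -/
def IsUnionOfConjClasses {G : Type u} [Group G] (C : Set G) : Prop :=
  ∃ T : Set (ConjClasses G), C = ⋃ c ∈ T, c.carrier

/-- `S` is Frobenian: up to finitely many elements it is `S_{L,C}` for some finite Galois extension
`L/K` and some union `C` of conjugacy classes of `Gal(L/K)`. (The `R`-algebra structure on `L` is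
the one that comes from `K`.) -/
def IsFrobenian {F : Type u} [Field F] (S : Set (MonicIrreducible F)) : Prop :=
  ∃ (L : Type u) (_ : Field L) (_ : Algebra F[X] L) (_ : Algebra (RatFunc F) L)
    (_ : IsScalarTower F[X] (RatFunc F) L) (_ : FiniteDimensional (RatFunc F) L)
    (_ : IsGalois (RatFunc F) L) (C : Set Gal(L/RatFunc F)),
    IsUnionOfConjClasses C ∧ (symmDiff S (hittingSet L C)).Finite

/-- The set of all monic irreducible `P` with `a_{q ^ deg P} ≡ 0 mod P`, where `q = #F`. -/
def zeroPrimes {F : Type u} [Field F] (a : ℕ → RatFunc F) : Set (MonicIrreducible F) :=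
  {P | CongrZeroMod (a (Nat.card F ^ (P : F[X]).natDegree)) (P : F[X])}

/-!
Write `q = #F`, `R = F[θ]`, `K = F(θ)`. The link between the two sides is a reduction of power
sums. Let `L / K` be finite Galois and let `∑ i, c i * α i ^ n` be a power sum with
`c i, α i ∈ L`. If `𝔭` is a prime of `R_L` over `P`, `d = deg P` and `σ` is a Frobenius map at
`𝔭`, then `α ^ (q ^ d) ≡ σ α mod 𝔭` for every `α` integral at `𝔭`. Hence, if
`a_{q ^ d} = ∑ i, c i * α i ^ (q ^ d)` for large `d`, then for all but finitely many `P` the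
condition `a_{q ^ deg P} ≡ 0 mod P` means that `∑ i, c i * σ (α i)` is divisible by `𝔭`. This
element is one of finitely many elements of `L`, so up to finitely many `P` the condition is that
it is zero, a condition on `σ` alone (`exists_natDegree_bound_mem_zeroPrimes_iff`).

Given a linear recurrent sequence whose characteristic polynomial is a product of separable
polynomials, take for `L` the splitting field. The roots may be multiple, but along the indices
`q ^ d` with `d` large the sequence is a power sum in the roots with constant coefficients
(`exists_eq_sum_pow_of_splits`). The set of `σ` at which the reduced sum vanishes need not be
shown to be conjugation-invariant: as Frobenius classes are nonempty and closed under conjugation,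
it may be replaced by the largest union of conjugacy classes in it
(`exists_isUnionOfConjClasses_hittingSet_eq`).

Conversely, given `L` and a union `C` of conjugacy classes, choose `x ∈ L` with `Tr x = 1`.
Interpolation at the conjugates of a primitive element gives `c i, α i ∈ L` such that
`∑ i, c i * σ (α i)` is `0` for `σ ∈ C` and `x` for `σ ∉ C`. The sequence
`a_n = Tr (∑ i, c i * α i ^ n)` has its values in `K`, and `∏ i, minpoly (α i)` is the
characteristic polynomial of a recurrence for it. As `C` is invariant under conjugation, the
reduced sum attached to this power sum in all `τ (c i)`, `τ (α i)` is `0` for `σ ∈ C` and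
`Tr x = 1` for `σ ∉ C` (`exists_linearRecurrence_symmDiff_zeroPrimes_finite`). Finally,
multiplication by a nonzero polynomial adds any given finite set of primes to the zero primes
(`exists_mul_zeroPrimes`).
-/

/-! ### Primes of bounded degree and residue fields -/

theorem MonicIrreducible.finite_setOf_natDegree_le (F : Type u) [Field F] [Finite F] (D : ℕ) :
    {P : MonicIrreducible F | (P : F[X]).natDegree ≤ D}.Finite := by
  have : Module.Finite F (degreeLT F (D + 1)) :=
    Module.Finite.equiv (degreeLTEquiv F (D + 1)).symm
  have : Finite (degreeLT F (D + 1)) := Module.finite_of_finite F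
  refine Set.Finite.of_finite_image (f := Subtype.val)
    ((Set.toFinite (degreeLT F (D + 1) : Set F[X])).subset ?_) Subtype.val_injective.injOn
  rintro _ ⟨P, hP, rfl⟩
  rw [SetLike.mem_coe, mem_degreeLT]
  exact degree_le_natDegree.trans_lt (by exact_mod_cast Nat.lt_succ_of_le hP)

theorem Polynomial.natCard_quotient_span_singleton {F : Type u} [Field F] {P : F[X]} (hP : P ≠ 0) :
    Nat.card (F[X] ⧸ Ideal.span {P}) = Nat.card F ^ P.natDegree := by
  have : Module.Finite F (F[X] ⧸ Ideal.span {P}) := (AdjoinRoot.powerBasis hP).finite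
  rw [Module.natCard_eq_pow_finrank (K := F), finrank_quotient_span_eq_natDegree]

section Injectivity

variable {F : Type u} [Field F]
variable (L : Type u) [Field L] [Algebra F[X] L] [Algebra (RatFunc F) L]
  [IsScalarTower F[X] (RatFunc F) L]

theorem algebraMap_polynomial_injective : Function.Injective (algebraMap F[X] L) := by
  rw [IsScalarTower.algebraMap_eq F[X] (RatFunc F) L]
  exact (algebraMap (RatFunc F) L).injective.comp (IsFractionRing.injective F[X] (RatFunc F))

theorem algebraMap_integralClosure_injective :
    Function.Injective (algebraMap F[X] (integralClosure F[X] L)) := fun _ _ h =>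
  algebraMap_polynomial_injective L (congrArg Subtype.val h)

end Injectivity

section Frobenius

variable {F : Type u} [Field F]
variable (L : Type u) [Field L] [Algebra F[X] L] [Algebra (RatFunc F) L]
  [IsScalarTower F[X] (RatFunc F) L] [FiniteDimensional (RatFunc F) L]

/-! ### Frobenius classes -/

/-- Every prime of `R_L` has finite residue field, and the decomposition group maps onto the Galois
group of the residue extension, so it contains a Frobenius map. -/
theorem frobeniusClass_nonempty [Finite F] [IsGalois (RatFunc F) L] (P : MonicIrreducible F) :
    (frobeniusClass L (P : F[X])).Nonempty := by
  have hP0 : (P : F[X]) ≠ 0 := P.2.2.ne_zero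
  have hprime : (Ideal.span {(P : F[X])}).IsPrime :=
    (Ideal.span_singleton_prime hP0).2 P.2.2.prime
  obtain ⟨𝔭, -, h𝔭, hu⟩ := Ideal.exists_ideal_over_prime_of_isIntegral
    (S := integralClosure F[X] L) (Ideal.span {(P : F[X])}) ⊥ (by
      rw [← RingHom.ker_eq_comap_bot, (RingHom.injective_iff_ker_eq_bot _).1
        (algebraMap_integralClosure_injective L)]
      exact bot_le)
  have : Module.Finite F[X] (integralClosure F[X] L) :=
    IsIntegralClosure.finite F[X] (RatFunc F) L (integralClosure F[X] L)
  have : Finite (F[X] ⧸ 𝔭.under F[X]) := by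
    refine Nat.finite_of_card_ne_zero ?_
    rw [Ideal.under_def, hu, natCard_quotient_span_singleton hP0]
    exact pow_ne_zero _ Nat.card_pos.ne'
  have : Module.Finite (F[X] ⧸ 𝔭.under F[X]) (integralClosure F[X] L ⧸ 𝔭) :=
    Module.Finite.of_restrictScalars_finite F[X] _ _
  have : Finite (integralClosure F[X] L ⧸ 𝔭) := Module.finite_of_finite (F[X] ⧸ 𝔭.under F[X])
  let := IsIntegralClosure.MulSemiringAction F[X] (RatFunc F) L (integralClosure F[X] L)
  have := IsIntegralClosure.isFractionRing_of_finite_extension F[X] (RatFunc F) L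
    (integralClosure F[X] L)
  have : SMulCommClass Gal(L/RatFunc F) F[X] (integralClosure F[X] L) :=
    ⟨fun σ x y => map_smul (galRestrict F[X] (RatFunc F) L (integralClosure F[X] L) σ) x y⟩
  have := Algebra.isInvariant_of_isGalois F[X] (RatFunc F) L (integralClosure F[X] L)
  obtain ⟨σ, hσ⟩ := IsArithFrobAt.exists_of_isInvariant F[X] Gal(L/RatFunc F) 𝔭
  exact ⟨σ, 𝔭, h𝔭, hu, hσ⟩

/-- If `σ` is a Frobenius map at `𝔭`, then `τ * σ * τ⁻¹` is one at the prime `τ 𝔭`, the preimage of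
`𝔭` under `τ⁻¹`. -/
theorem conj_mem_frobeniusClass {P : F[X]} {σ : Gal(L/RatFunc F)} (hσ : σ ∈ frobeniusClass L P)
    (τ : Gal(L/RatFunc F)) : τ * σ * τ⁻¹ ∈ frobeniusClass L P := by
  obtain ⟨𝔭, h𝔭, hu, hF⟩ := hσ
  let g : integralClosure F[X] L →ₐ[F[X]] integralClosure F[X] L :=
    (galRestrict F[X] (RatFunc F) L (integralClosure F[X] L) τ⁻¹).toAlgHom
  have hunder : (𝔭.comap g).under F[X] = 𝔭.under F[X] := by
    rw [Ideal.under_def, Ideal.under_def]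
    exact (Ideal.comap_comap _ _).trans (congrArg (fun f => Ideal.comap f 𝔭) g.comp_algebraMap)
  refine ⟨𝔭.comap g, Ideal.IsPrime.comap _, hunder.trans hu, fun x => ?_⟩
  have h := hF (g x)
  rw [hunder, Ideal.mem_comap, map_sub, map_pow]
  convert h using 2
  apply Subtype.ext
  change algebraMap (integralClosure F[X] L) L _ = algebraMap (integralClosure F[X] L) L _
  simp [g, algebraMap_galRestrict_apply]

end Frobenius

/-! ### Reduction of power sums modulo primes -/

/-- A nonzero integral element lies in no prime over a polynomial `P` of large degree, because it
divides a nonzero polynomial. -/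
theorem exists_natDegree_bound_of_mem {F : Type u} [Field F]
    (L : Type u) [Field L] [Algebra F[X] L] (e : integralClosure F[X] L) :
    ∃ D : ℕ, ∀ (P : F[X]) (𝔭 : Ideal (integralClosure F[X] L)),
      𝔭.under F[X] = Ideal.span {P} → D < P.natDegree → (e ∈ 𝔭 ↔ e = 0) := by
  rcases eq_or_ne e 0 with rfl | he
  · exact ⟨0, fun P 𝔭 _ _ => by simp⟩
  obtain ⟨r, hr, hdvd⟩ := IsAlgebraic.exists_nonzero_dvd (R := F[X])
    (Algebra.IsIntegral.isIntegral e).isAlgebraic (mem_nonZeroDivisors_of_ne_zero he)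
  refine ⟨r.natDegree, fun P 𝔭 hu hD => ⟨fun hmem => absurd hD ?_, fun h => absurd h he⟩⟩
  have hrP : r ∈ Ideal.span {P} := by
    rw [← hu]
    exact 𝔭.mem_of_dvd hdvd hmem
  exact not_lt.2 (natDegree_le_of_dvd (Ideal.mem_span_singleton.1 hrP) hr)

section Reduction

variable {F : Type u} [Field F]
variable (L : Type u) [Field L] [Algebra F[X] L] [Algebra (RatFunc F) L]
  [IsScalarTower F[X] (RatFunc F) L]

/-- For `a ∈ K` and `s ∈ R` prime to `P` such that `s a` is integral, `a ≡ 0 mod P` can be tested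
at any prime over `P`. -/
theorem congrZeroMod_iff_mem {P : F[X]} {𝔭 : Ideal (integralClosure F[X] L)}
    (h𝔭 : 𝔭.IsPrime) (hu : 𝔭.under F[X] = Ideal.span {P}) {a : RatFunc F} {s : F[X]}
    (hs : ¬ P ∣ s) {e : integralClosure F[X] L}
    (he : (e : L) = algebraMap F[X] L s * algebraMap (RatFunc F) L a) :
    CongrZeroMod a P ↔ e ∈ 𝔭 := by
  have hmem (x : F[X]) : algebraMap F[X] (integralClosure F[X] L) x ∈ 𝔭 ↔ P ∣ x := by
    rw [← Ideal.mem_span_singleton, ← hu]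
    rfl
  have h0 (x : F[X]) (hx : ¬ P ∣ x) : algebraMap F[X] (RatFunc F) x ≠ 0 := by
    rw [Ne, IsFractionRing.to_map_eq_zero_iff]
    rintro rfl
    exact hx (dvd_zero P)
  constructor
  · rintro ⟨r, w, hr, hw, rfl⟩
    have h : algebraMap F[X] (integralClosure F[X] L) w * e
        = algebraMap F[X] (integralClosure F[X] L) (s * r) := by
      apply Subtype.ext
      change algebraMap F[X] L w * (e : L) = algebraMap F[X] L (s * r)
      rw [he]
      simp only [IsScalarTower.algebraMap_apply F[X] (RatFunc F) L, ← map_mul]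
      congr 1
      have := h0 w hw
      rw [map_mul]
      field_simp
    have h' : algebraMap F[X] (integralClosure F[X] L) w * e ∈ 𝔭 :=
      h ▸ (hmem _).2 (hr.mul_left s)
    exact (h𝔭.mem_or_mem h').resolve_left fun h'' => hw ((hmem w).1 h'')
  · intro h
    have hint : IsIntegral F[X] (algebraMap F[X] (RatFunc F) s * a) := by
      have h1 : IsIntegral F[X] (algebraMap (RatFunc F) L (algebraMap F[X] (RatFunc F) s * a)) := by
        rw [map_mul, ← IsScalarTower.algebraMap_apply, ← he]
        exact e.2
      exact (isIntegral_algebraMap_iff (algebraMap (RatFunc F) L).injective).1 h1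
    obtain ⟨r, hr⟩ := IsIntegrallyClosed.isIntegral_iff.1 hint
    have her : e = algebraMap F[X] (integralClosure F[X] L) r := by
      apply Subtype.ext
      change (e : L) = algebraMap F[X] L r
      rw [he, IsScalarTower.algebraMap_apply F[X] (RatFunc F) L r, hr, map_mul,
        ← IsScalarTower.algebraMap_apply]
    refine ⟨r, s, (hmem r).1 (her ▸ h), hs, ?_⟩
    rw [hr]
    have := h0 s hs
    field_simp

/-- If `a` is eventually given by the power sum `∑ i, c i * α i ^ n` along the powers of `q`, then
`a_{q ^ deg P} ≡ ∑ i, c i * σ (α i)` modulo a prime `𝔭` over `P` with Frobenius map `σ`, for all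
but finitely many `P`. The right-hand side is one of finitely many elements of `L`, so it vanishes
modulo `𝔭` only if it vanishes, up to finitely many further `P`. -/
theorem exists_natDegree_bound_mem_zeroPrimes_iff [Finite F]
    [FiniteDimensional (RatFunc F) L] {ι : Type*} [Fintype ι]
    (c α : ι → L) (a : ℕ → RatFunc F) (d₀ : ℕ)
    (ha : ∀ d ≥ d₀, algebraMap (RatFunc F) L (a (Nat.card F ^ d)) =
      ∑ i, c i * α i ^ Nat.card F ^ d) :
    ∃ D : ℕ, ∀ P : MonicIrreducible F, D < (P : F[X]).natDegree →
      ∀ σ ∈ frobeniusClass L (P : F[X]), P ∈ zeroPrimes a ↔ ∑ i, c i * σ (α i) = 0 := by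
  classical
  obtain ⟨s, hs0, hs⟩ := exists_integral_multiples F[X] (RatFunc F)
    (Finset.univ.image c ∪ Finset.univ.image α)
  -- `s` clears the denominators of all `c i` and `α i`
  let γ : ι → integralClosure F[X] L := fun i => ⟨s • c i, hs _ (by simp)⟩
  let β : ι → integralClosure F[X] L := fun i => ⟨s • α i, hs _ (by simp)⟩
  let g := galRestrict F[X] (RatFunc F) L (integralClosure F[X] L)
  let ε : Gal(L/RatFunc F) → integralClosure F[X] L := fun σ => ∑ i, γ i * g σ (β i)
  have hε (σ) : ε σ = 0 ↔ ∑ i, c i * σ (α i) = 0 := by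
    have h : (ε σ : L) = algebraMap F[X] L s ^ 2 * ∑ i, c i * σ (α i) := by
      change algebraMap (integralClosure F[X] L) L (ε σ) = _
      have hσ : σ (algebraMap F[X] L s) = algebraMap F[X] L s := by
        rw [IsScalarTower.algebraMap_apply F[X] (RatFunc F) L, AlgEquiv.commutes]
      simp only [ε, map_sum, map_mul, g, algebraMap_galRestrict_apply]
      rw [Finset.mul_sum]
      refine Finset.sum_congr rfl fun i _ => ?_
      change (s • c i) * σ (s • α i) = _
      rw [Algebra.smul_def, Algebra.smul_def, map_mul, hσ]
      ring
    have hs' : algebraMap F[X] L s ^ 2 ≠ 0 := pow_ne_zero 2 fun h =>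
      hs0 ((map_eq_zero_iff _ (algebraMap_polynomial_injective L)).1 h)
    rw [← ZeroMemClass.coe_eq_zero, h, mul_eq_zero, or_iff_right hs']
  choose D hD using fun σ => exists_natDegree_bound_of_mem L (ε σ)
  obtain ⟨D', hD'⟩ := (Set.finite_range D).bddAbove
  refine ⟨max D' (max s.natDegree d₀), fun P hP σ hσ => ?_⟩
  obtain ⟨𝔭, h𝔭, hu, hF⟩ := hσ
  simp only [max_lt_iff] at hP
  have hDσ : D σ < (P : F[X]).natDegree := (hD' ⟨σ, rfl⟩).trans_lt hP.1
  have hPp : Prime (P : F[X]) := P.2.2.prime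
  have hPs : ¬ (P : F[X]) ∣ s := fun h => absurd hP.2.1 (not_lt.2 (natDegree_le_of_dvd h hs0))
  set N := Nat.card F ^ (P : F[X]).natDegree
  have hcard : Nat.card (F[X] ⧸ 𝔭.under F[X]) = N := by
    rw [hu, natCard_quotient_span_singleton P.2.2.ne_zero]
  have hE : ((∑ i, γ i * β i ^ N : integralClosure F[X] L) : L)
      = algebraMap F[X] L (s ^ (1 + N)) * algebraMap (RatFunc F) L (a N) := by
    change algebraMap (integralClosure F[X] L) L _ = _
    rw [ha _ hP.2.2.le, Finset.mul_sum, map_sum]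
    refine Finset.sum_congr rfl fun i _ => ?_
    rw [map_mul, map_pow]
    change (s • c i) * (s • α i) ^ N = _
    rw [Algebra.smul_def, Algebra.smul_def, map_pow]
    ring
  have hsub : ε σ - ∑ i, γ i * β i ^ N ∈ 𝔭 := by
    simp only [ε, ← Finset.sum_sub_distrib, ← mul_sub]
    refine sum_mem fun i _ => 𝔭.mul_mem_left _ ?_
    have := hF (β i)
    rwa [hcard] at this
  change CongrZeroMod (a N) (P : F[X]) ↔ _
  rw [congrZeroMod_iff_mem L h𝔭 hu (fun h => hPs (hPp.dvd_of_dvd_pow h)) hE, ← hε,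
    ← hD σ P 𝔭 hu hDσ]
  exact ⟨fun h => by simpa using add_mem hsub h, fun h => by simpa using sub_mem h hsub⟩

end Reduction

/-! ### Linear recurrences as functionals on polynomials -/

/-- The linear functional on `K[X]` sending `X ^ n` to `a n`. -/
noncomputable def seqFunctional {K M : Type*} [CommRing K] [AddCommGroup M] [Module K M]
    (a : ℕ → M) : K[X] →ₗ[K] M :=
  Polynomial.lsum fun n => LinearMap.toSpanSingleton K M (a n)

theorem seqFunctional_monomial {K M : Type*} [CommRing K] [AddCommGroup M] [Module K M]
    (a : ℕ → M) (n : ℕ) (r : K) : seqFunctional a (monomial n r) = r • a n := by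
  simp [seqFunctional, Polynomial.lsum_apply]

/-- A sequence solves a recurrence if and only if its functional kills the ideal generated by the
characteristic polynomial. -/
theorem LinearRecurrence.isSolution_iff_seqFunctional {K : Type*} [Field K]
    (E : LinearRecurrence K) (a : ℕ → K) :
    E.IsSolution a ↔ ∀ h : K[X], seqFunctional a (E.charPoly * h) = 0 := by
  have key (n : ℕ) (r : K) : seqFunctional a (E.charPoly * monomial n r)
      = r * (a (n + E.order) - ∑ i, E.coeffs i * a (n + i)) := by
    simp only [LinearRecurrence.charPoly, sub_mul, Finset.sum_mul, monomial_mul_monomial, map_sub,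
      map_sum, seqFunctional_monomial, smul_eq_mul, mul_sub, Finset.mul_sum, one_mul]
    congr 1
    · rw [add_comm]
    · exact Finset.sum_congr rfl fun i _ => by rw [add_comm n]; ring
  constructor
  · intro ha h
    induction h using Polynomial.induction_on' with
    | add p q hp hq => rw [mul_add, map_add, hp, hq, add_zero]
    | monomial n r => rw [key, ha n, sub_self, mul_zero]
  · intro h n
    have := key n 1
    rw [h, one_mul] at this
    exact sub_eq_zero.1 this.symm

theorem exists_linearRecurrence_charPoly {K : Type*} [Field K] {p : K[X]} (hp : p.Monic) :
    ∃ E : LinearRecurrence K, E.charPoly = p := by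
  refine ⟨⟨p.natDegree, fun i => -p.coeff i⟩, ?_⟩
  rw [LinearRecurrence.charPoly]
  simp only [map_neg, Finset.sum_neg_distrib, sub_neg_eq_add]
  conv_rhs => rw [p.as_sum_range, Finset.sum_range_succ, hp.coeff_natDegree]
  rw [add_comm, Finset.sum_range]

/-- If the functional of a sequence over `K` kills the ideal `(f)`, then the functional of the
same sequence, viewed over an extension field `L`, kills the ideal `(f) L[X]`. -/
theorem seqFunctional_map_mul_eq_zero {K L : Type*} [Field K] [Field L] [Algebra K L]
    {a : ℕ → K} {f : K[X]} (h : ∀ g : K[X], seqFunctional a (f * g) = 0) (g : L[X]) :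
    seqFunctional (fun n => algebraMap K L (a n)) (f.map (algebraMap K L) * g) = 0 := by
  have hmap (p : K[X]) : seqFunctional (fun n => algebraMap K L (a n)) (p.map (algebraMap K L))
      = algebraMap K L (seqFunctional a p) := by
    induction p using Polynomial.induction_on' with
    | add p q hp hq => rw [Polynomial.map_add, map_add, map_add, map_add, hp, hq]
    | monomial n r => simp [seqFunctional_monomial]
  induction g using Polynomial.induction_on' with
  | add p q hp hq => rw [mul_add, map_add, hp, hq, add_zero]
  | monomial n r =>
    have : f.map (algebraMap K L) * monomial n r = r • (f * monomial n 1).map (algebraMap K L) := by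
      rw [Polynomial.map_mul, map_monomial, map_one, ← mul_smul_comm, smul_monomial, smul_eq_mul,
        mul_one]
    rw [this, map_smul, hmap, h, map_zero, smul_zero]

/-! ### Power sums along powers of the characteristic -/

/-- Along the multiples of a power `Q` of the characteristic with `Q ≥ deg f`, a linear recurrent
sequence is a power sum in the roots of `f`, whatever their multiplicities: `f` divides
`∏ (X - α) ^ Q = ∏ (X ^ Q - α ^ Q)`, and modulo the latter `X ^ (Q * N)` is found by Lagrange
interpolation at the distinct points `α ^ Q`. -/
theorem exists_eq_sum_pow_of_splits {L : Type*} [Field L] (p : ℕ) [ExpChar L p] {f : L[X]}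
    (hf : f.Monic) (hs : f.Splits) {a : ℕ → L}
    (ha : ∀ g : L[X], seqFunctional a (f * g) = 0) (k : ℕ) (hk : f.natDegree ≤ p ^ k) :
    ∃ (T : Finset L) (c : L → L), ∀ N, a (p ^ k * N) = ∑ x ∈ T, c x * x ^ (p ^ k * N) := by
  classical
  set T := f.roots.toFinset
  set Q := p ^ k with hQ
  have hinj : Set.InjOn (fun x : L => x ^ Q) T :=
    (iterateFrobenius_inj L p k).injOn
  have hdvd : f ∣ ∏ x ∈ T, (X ^ Q - C (x ^ Q)) := by
    have h1 : f = ∏ x ∈ T, (X - C x) ^ f.roots.count x := by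
      conv_lhs => rw [hs.eq_prod_roots, hf.leadingCoeff, C_1, one_mul,
        Finset.prod_multiset_map_count]
    rw [h1]
    refine Finset.prod_dvd_prod_of_dvd _ _ fun x _ => ?_
    rw [C_pow, hQ, ← sub_pow_expChar_pow]
    exact pow_dvd_pow _ ((Multiset.count_le_card _ _).trans ((card_roots' f).trans hk))
  let b : L → L[X] := Lagrange.basis T fun x => x ^ Q
  refine ⟨T, fun x => seqFunctional a (expand L Q (b x)), fun N => ?_⟩
  have hnodal : Lagrange.nodal T (fun x => x ^ Q) ∣
      X ^ N - ∑ x ∈ T, C (x ^ (Q * N)) * b x := by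
    rw [Lagrange.nodal_eq]
    refine Finset.prod_dvd_of_coprime (fun x hx y hy hxy => ?_) fun x hx => ?_
    · exact pairwise_coprime_X_sub_C (s := fun x : T => (x : L) ^ Q)
        (fun x y h => Subtype.ext (hinj x.2 y.2 h)) (i := ⟨x, hx⟩) (j := ⟨y, hy⟩)
        (fun h => hxy (congrArg Subtype.val h))
    · rw [dvd_iff_isRoot, IsRoot.def, eval_sub, eval_finsetSum, Finset.sum_eq_single x]
      · rw [eval_mul, Lagrange.eval_basis_self hinj hx]
        simp [pow_mul]
      · intro y _ hyx
        rw [eval_mul]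
        exact mul_eq_zero_of_right _ (Lagrange.eval_basis_of_ne hyx hx)
      · exact fun h => absurd hx h
  obtain ⟨g, hg⟩ := hnodal
  obtain ⟨g', hg'⟩ := hdvd
  have h := congrArg (expand L Q) hg
  rw [Lagrange.nodal_eq, map_mul, map_prod] at h
  simp only [map_sub, map_sum, map_mul, map_pow (expand L Q), expand_X, expand_C] at h
  rw [hg', mul_assoc] at h
  have h' := congrArg (seqFunctional a) h
  rw [ha, map_sub, map_sum, sub_eq_zero, ← pow_mul, ← monomial_one_right_eq_X_pow,
    seqFunctional_monomial, one_smul] at h'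
  rw [h']
  refine Finset.sum_congr rfl fun x _ => ?_
  rw [← smul_eq_C_mul, map_smul, smul_eq_mul, mul_comm]

/-! ### From recurrences to Frobenius classes -/

theorem IsProdOfSeparable.isGalois_splittingField {K : Type u} [Field K] {f : K[X]}
    (hf : IsProdOfSeparable f) (hf0 : f ≠ 0) : IsGalois K f.SplittingField := by
  obtain ⟨s, hs, rfl⟩ := hf
  have hsep : ∀ x ∈ s.prod.rootSet s.prod.SplittingField, IsSeparable K x := by
    intro x hx
    have hx0 : aeval x s.prod = 0 := ((mem_rootSet.1 hx).2)
    rw [map_multiset_prod, Multiset.prod_eq_zero_iff] at hx0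
    obtain ⟨g, hg, hgx⟩ := Multiset.mem_map.1 hx0
    exact (hs g hg).of_dvd (minpoly.dvd K x hgx)
  have htop : IntermediateField.adjoin K (s.prod.rootSet s.prod.SplittingField) = ⊤ :=
    IntermediateField.adjoin_eq_top_of_algebra K _ (SplittingField.adjoin_rootSet s.prod)
  have h := (IntermediateField.isSeparable_adjoin_iff_isSeparable K s.prod.SplittingField).2 hsep
  rw [htop] at h
  have : Algebra.IsSeparable K s.prod.SplittingField :=
    AlgEquiv.Algebra.isSeparable IntermediateField.topEquiv
  have : Normal K s.prod.SplittingField := Normal.of_isSplittingField s.prod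
  exact ⟨⟩

section Frobenius

variable {F : Type u} [Field F]
variable (L : Type u) [Field L] [Algebra F[X] L] [Algebra (RatFunc F) L]
  [IsScalarTower F[X] (RatFunc F) L] [FiniteDimensional (RatFunc F) L]

/-- A condition on `P` that is tested by membership in `C` of any element of the Frobenius class of
`P` holds exactly on `S_{L,C}`, because Frobenius classes are not empty. -/
theorem iff_mem_hittingSet_of_forall [Finite F] [IsGalois (RatFunc F) L] {p : Prop}
    {P : MonicIrreducible F} {C : Set Gal(L/RatFunc F)}
    (h : ∀ σ ∈ frobeniusClass L (P : F[X]), p ↔ σ ∈ C) : p ↔ P ∈ hittingSet L C := by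
  refine ⟨fun hp σ hσ => (h σ hσ).1 hp, fun hP => ?_⟩
  obtain ⟨σ, hσ⟩ := frobeniusClass_nonempty L P
  exact (h σ hσ).2 (hP hσ)

/-- `S_{L,C}` depends only on the largest union of conjugacy classes inside `C`. -/
theorem exists_isUnionOfConjClasses_hittingSet_eq (C : Set Gal(L/RatFunc F)) :
    ∃ C', IsUnionOfConjClasses C' ∧ hittingSet L C' = hittingSet L C := by
  -- since Frobenius classes are stable under conjugation, the other elements of `C` do not matter
  refine ⟨⋃ c ∈ {c : ConjClasses Gal(L/RatFunc F) | c.carrier ⊆ C}, c.carrier, ⟨_, rfl⟩, ?_⟩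
  ext P
  constructor
  · intro h σ hσ
    obtain ⟨c, hc, hσc⟩ := Set.mem_iUnion₂.1 (h hσ)
    exact hc hσc
  · intro h σ hσ
    refine Set.mem_iUnion₂.2 ⟨ConjClasses.mk σ, fun g hg => ?_, ConjClasses.mem_carrier_mk⟩
    rw [ConjClasses.mem_carrier_iff_mk_eq, ConjClasses.mk_eq_mk_iff_isConj, isConj_comm,
      isConj_iff] at hg
    obtain ⟨τ, rfl⟩ := hg
    exact h (conj_mem_frobeniusClass L hσ τ)

end Frobenius

theorem symmDiff_finite_of_natDegree_bound {F : Type u} [Field F] [Finite F]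
    {S T : Set (MonicIrreducible F)} (D : ℕ)
    (h : ∀ P : MonicIrreducible F, D < (P : F[X]).natDegree → (P ∈ S ↔ P ∈ T)) :
    (symmDiff S T).Finite := by
  refine (MonicIrreducible.finite_setOf_natDegree_le F D).subset fun P hP => ?_
  rw [Set.mem_ofPred_eq]
  by_contra hD
  have := h P (not_le.1 hD)
  rw [Set.mem_symmDiff] at hP
  tauto

/-- The field `L` is the splitting field of the characteristic polynomial, and `C` comes from the
`σ` at which the power sum `∑ x, c x * σ x`, over the roots `x`, vanishes. -/
theorem isFrobenian_of_linearRecurrence {F : Type u} [Field F] [Finite F]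
    {E : LinearRecurrence (RatFunc F)} {a : ℕ → RatFunc F} (ha : E.IsSolution a)
    (hE : IsProdOfSeparable E.charPoly) {S : Set (MonicIrreducible F)}
    (hS : (symmDiff S (zeroPrimes a)).Finite) : IsFrobenian S := by
  set f := E.charPoly with hf
  have hmonic : f.Monic := E.charPoly_monic
  let L := f.SplittingField
  have hG : IsGalois (RatFunc F) L := hE.isGalois_splittingField hmonic.ne_zero
  have : FiniteDimensional (RatFunc F) L := inferInstance
  -- the cardinality of `F` is a power `p ^ n` of the characteristic exponent `p`
  obtain ⟨p, hp⟩ := CharP.exists F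
  have := Fintype.ofFinite F
  obtain ⟨n, hpp, hn⟩ := FiniteField.card F p
  have hq : Nat.card F = p ^ (n : ℕ) := by rw [Nat.card_eq_fintype_card, hn]
  have : CharP L p := charP_of_injective_algebraMap
    ((algebraMap (RatFunc F) L).comp (algebraMap F (RatFunc F))).injective p
  have : ExpChar L p := .prime hpp
  have hf' (g : L[X]) := seqFunctional_map_mul_eq_zero (L := L)
    ((E.isSolution_iff_seqFunctional a).1 ha) g
  -- `Q = p ^ (n * deg f) = q ^ deg f` exceeds the multiplicity of every root of `f`
  obtain ⟨T, c, hc⟩ := exists_eq_sum_pow_of_splits p (hmonic.map (algebraMap (RatFunc F) L))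
    (SplittingField.splits f) hf' (n * f.natDegree) (by
      rw [natDegree_map, pow_mul, ← hq]
      exact (Nat.lt_pow_self Finite.one_lt_card).le)
  obtain ⟨D, hD⟩ := exists_natDegree_bound_mem_zeroPrimes_iff L (fun x : T => c x)
    (fun x : T => (x : L)) a f.natDegree (by
      intro d hd
      obtain ⟨e, rfl⟩ := Nat.exists_eq_add_of_le hd
      have h := hc (Nat.card F ^ e)
      rw [pow_mul, ← hq, ← pow_add] at h
      rw [h, ← Finset.sum_coe_sort T])
  obtain ⟨C', hC', hCC'⟩ := exists_isUnionOfConjClasses_hittingSet_eq L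
    {σ : Gal(L/RatFunc F) | ∑ x : T, c x * σ (x : L) = 0}
  refine ⟨L, inferInstance, inferInstance, inferInstance, inferInstance, inferInstance, hG, C',
    hC', ?_⟩
  rw [hCC']
  have h := symmDiff_finite_of_natDegree_bound D fun P hP =>
    iff_mem_hittingSet_of_forall L (hD P hP)
  exact (hS.union h).subset (symmDiff_triangle _ _ _)

/-! ### From Frobenius classes to recurrences -/

/-- The trace of a power sum `∑ i, c i * α i ^ n` is a linear recurrent sequence whose
characteristic polynomial may be taken to be the product of the minimal polynomials of the `α i`. It
has multiple roots if some of the `α i` are conjugate. -/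
theorem exists_linearRecurrence_trace_sum {K : Type u} {L : Type*} [Field K] [Field L] [Algebra K L]
    [FiniteDimensional K L] [Algebra.IsSeparable K L] {ι : Type*} [Fintype ι] (c α : ι → L) :
    ∃ E : LinearRecurrence K, IsProdOfSeparable E.charPoly ∧
      E.IsSolution fun n => Algebra.trace K L (∑ i, c i * α i ^ n) := by
  obtain ⟨E, hE⟩ := exists_linearRecurrence_charPoly (K := K) (p := ∏ i, minpoly K (α i))
    (monic_prod_of_monic _ _ fun i _ => minpoly.monic (Algebra.IsIntegral.isIntegral _))
  refine ⟨E, ⟨Finset.univ.val.map fun i => minpoly K (α i), ?_, hE.symm⟩, ?_⟩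
  · intro f hf
    obtain ⟨i, -, rfl⟩ := Multiset.mem_map.1 hf
    exact Algebra.IsSeparable.isSeparable K (α i)
  have key (h : K[X]) : seqFunctional (fun n => Algebra.trace K L (∑ i, c i * α i ^ n)) h
      = Algebra.trace K L (∑ i, c i * aeval (α i) h) := by
    induction h using Polynomial.induction_on' with
    | add p q hp hq => simp only [map_add, mul_add, Finset.sum_add_distrib, hp, hq]
    | monomial n r =>
      rw [seqFunctional_monomial, ← map_smul, Finset.smul_sum]
      congr 1
      refine Finset.sum_congr rfl fun i _ => ?_
      rw [aeval_monomial, Algebra.smul_def]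
      ring
  rw [LinearRecurrence.isSolution_iff_seqFunctional]
  intro h
  rw [key, hE, Finset.sum_eq_zero, map_zero]
  intro i _
  rw [map_mul, map_prod, Finset.prod_eq_zero (Finset.mem_univ i) (minpoly.aeval K (α i)), zero_mul,
    mul_zero]

/-- Every function `ψ` on the Galois group has the form `σ ↦ ∑ i, c i * σ (α i)`: for a primitive
element `x` of `L`, interpolate `ψ` at the distinct points `σ x`. -/
theorem exists_sum_mul_algEquiv_eq {K L : Type*} [Field K] [Field L] [Algebra K L]
    [FiniteDimensional K L] [Algebra.IsSeparable K L] (ψ : Gal(L/K) → L) :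
    ∃ (m : ℕ) (c α : Fin m → L), ∀ σ : Gal(L/K), ∑ i, c i * σ (α i) = ψ σ := by
  obtain ⟨x, hx⟩ := Field.exists_primitive_element K L
  have hinj (σ τ : Gal(L/K)) (h : σ x = τ x) : σ = τ := by
    have hadj : Algebra.adjoin K {x} = ⊤ := by
      rw [← IntermediateField.adjoin_simple_toSubalgebra_of_isAlgebraic
        (Algebra.IsAlgebraic.isAlgebraic x), hx, IntermediateField.top_toSubalgebra]
    have : (σ : L →ₐ[K] L) = τ := AlgHom.ext_of_adjoin_eq_top hadj (by simpa using h)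
    exact AlgEquiv.ext fun y => DFunLike.congr_fun this y
  obtain ⟨g, hg⟩ := (Polynomial.exists_eval_eq_iff (fun σ : Gal(L/K) => σ x) ψ).2
    fun σ τ h => congrArg ψ (hinj σ τ h)
  refine ⟨g.natDegree + 1, fun i => g.coeff i, fun i => x ^ (i : ℕ), fun σ => ?_⟩
  rw [← hg σ, eval_eq_sum_range, Finset.sum_range]
  simp only [map_pow]

/-- For every union `C` of conjugacy classes there is a linear recurrent sequence whose zero primes
are, up to finitely many, those of `S_{L,C}`. It is `n ↦ Tr (∑ i, c i * α i ^ n)`, where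
`∑ i, c i * σ (α i)` is `0` for `σ ∈ C` and an element of trace `1` for `σ ∉ C`. -/
theorem exists_linearRecurrence_symmDiff_zeroPrimes_finite {F : Type u} [Field F] [Finite F]
    (L : Type u) [Field L] [Algebra F[X] L] [Algebra (RatFunc F) L]
    [IsScalarTower F[X] (RatFunc F) L] [FiniteDimensional (RatFunc F) L] [IsGalois (RatFunc F) L]
    {C : Set Gal(L/RatFunc F)} (hC : IsUnionOfConjClasses C) :
    ∃ (E : LinearRecurrence (RatFunc F)) (a : ℕ → RatFunc F), E.IsSolution a ∧
      IsProdOfSeparable E.charPoly ∧ (symmDiff (zeroPrimes a) (hittingSet L C)).Finite := by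
  classical
  have hconj (σ τ : Gal(L/RatFunc F)) : τ⁻¹ * σ * τ ∈ C ↔ σ ∈ C := by
    obtain ⟨T, rfl⟩ := hC
    have h : ConjClasses.mk (τ⁻¹ * σ * τ) = ConjClasses.mk σ := by
      rw [ConjClasses.mk_eq_mk_iff_isConj, isConj_comm, isConj_iff]
      exact ⟨τ⁻¹, by rw [inv_inv]⟩
    simp only [Set.mem_iUnion, ConjClasses.mem_carrier_iff_mk_eq, h]
  obtain ⟨lam, hlam⟩ := Algebra.trace_surjective (RatFunc F) L 1
  obtain ⟨m, c, α, hcα⟩ := exists_sum_mul_algEquiv_eq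
    fun σ : Gal(L/RatFunc F) => if σ ∈ C then 0 else lam
  obtain ⟨E, hE, hsol⟩ := exists_linearRecurrence_trace_sum (K := RatFunc F) c α
  refine ⟨E, _, hsol, hE, ?_⟩
  obtain ⟨D, hD⟩ := exists_natDegree_bound_mem_zeroPrimes_iff L
    (fun x : Gal(L/RatFunc F) × Fin m => x.1 (c x.2)) (fun x => x.1 (α x.2))
    (fun n => Algebra.trace (RatFunc F) L (∑ i, c i * α i ^ n)) 0 (by
      intro d _
      rw [trace_eq_sum_automorphisms, Fintype.sum_prod_type]
      simp only [map_sum, map_mul, map_pow])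
  refine symmDiff_finite_of_natDegree_bound D fun P hP =>
    iff_mem_hittingSet_of_forall L fun σ hσ => (hD P hP σ hσ).trans ?_
  have hsum : ∑ x : Gal(L/RatFunc F) × Fin m, x.1 (c x.2) * σ (x.1 (α x.2))
      = if σ ∈ C then 0 else 1 := by
    -- as `C` is stable under conjugation, the `τ`-part of the sum is the `τ`-conjugate of the value
    -- at `τ⁻¹ * σ * τ` of the chosen function
    have hτ (τ : Gal(L/RatFunc F)) : ∑ i, τ (c i) * σ (τ (α i))
        = τ (if σ ∈ C then 0 else lam) := by
      have h := congrArg τ (hcα (τ⁻¹ * σ * τ))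
      simp only [hconj, map_sum, map_mul, AlgEquiv.mul_apply] at h
      rw [← h]
      refine Finset.sum_congr rfl fun i _ => ?_
      congr 1
      exact (AlgEquiv.apply_symm_apply τ _).symm
    rw [Fintype.sum_prod_type]
    simp only [hτ]
    rw [← trace_eq_sum_automorphisms (K := RatFunc F)]
    split_ifs
    · rw [map_zero, map_zero]
    · rw [hlam, map_one]
  rw [hsum]
  simp

/-! ### Adjusting finitely many primes -/

theorem congrZeroMod_mul_iff {F : Type u} [Field F] {P t : F[X]} (hP : Prime P) (ht : ¬ P ∣ t)
    (a : RatFunc F) : CongrZeroMod (algebraMap F[X] (RatFunc F) t * a) P ↔ CongrZeroMod a P := by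
  have ht0 : algebraMap F[X] (RatFunc F) t ≠ 0 := by
    rw [Ne, IsFractionRing.to_map_eq_zero_iff]
    rintro rfl
    exact ht (dvd_zero P)
  constructor
  · rintro ⟨r, s, hr, hs, h⟩
    refine ⟨r, t * s, hr, fun h => (hP.dvd_or_dvd h).elim ht hs, ?_⟩
    rw [map_mul, div_mul_eq_div_div_swap, ← h, mul_div_cancel_left₀ _ ht0]
  · rintro ⟨r, s, hr, hs, rfl⟩
    exact ⟨t * r, s, hr.mul_left t, hs, by rw [map_mul, mul_div_assoc]⟩

/-- Multiplication by a suitable nonzero polynomial puts any finite set of primes into the set of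
zero primes and changes it at only finitely many primes. -/
theorem exists_mul_zeroPrimes {F : Type u} [Field F] [Finite F] (a : ℕ → RatFunc F)
    {T : Set (MonicIrreducible F)} (hT : T.Finite) :
    ∃ t : F[X], T ⊆ zeroPrimes (fun n => algebraMap F[X] (RatFunc F) t * a n) ∧
      zeroPrimes a ⊆ zeroPrimes (fun n => algebraMap F[X] (RatFunc F) t * a n) ∧
      (zeroPrimes (fun n => algebraMap F[X] (RatFunc F) t * a n) \ zeroPrimes a).Finite := by
  let b : MonicIrreducible F → RatFunc F := fun P => a (Nat.card F ^ (P : F[X]).natDegree)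
  set t : F[X] := ∏ P ∈ hT.toFinset, (P : F[X]) * (b P).denom
  have ht0 : t ≠ 0 := Finset.prod_ne_zero_iff.2 fun P _ =>
    mul_ne_zero P.2.2.ne_zero (RatFunc.denom_ne_zero _)
  refine ⟨t, fun P hP => ?_, ?_, ?_⟩
  · obtain ⟨u, hu⟩ : (P : F[X]) * (b P).denom ∣ t :=
      Finset.dvd_prod_of_mem (fun P : MonicIrreducible F => (P : F[X]) * (b P).denom)
        (hT.mem_toFinset.2 hP)
    refine ⟨P * (b P).num * u, 1, (Dvd.intro _ rfl).mul_right u, P.2.2.prime.not_dvd_one, ?_⟩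
    change algebraMap F[X] (RatFunc F) t * b P = _
    have hd : algebraMap F[X] (RatFunc F) (b P).denom ≠ 0 := by
      rw [Ne, IsFractionRing.to_map_eq_zero_iff]
      exact RatFunc.denom_ne_zero _
    have hb := (RatFunc.num_div_denom (b P)).symm
    generalize (b P).num = n, (b P).denom = d at *
    rw [hu, hb]
    simp only [map_mul, map_one]
    field_simp
  · rintro P ⟨r, s, hr, hs, h⟩
    exact ⟨t * r, s, hr.mul_left t, hs, by rw [map_mul, mul_div_assoc, ← h]⟩
  · refine (MonicIrreducible.finite_setOf_natDegree_le F t.natDegree).subset fun P hP => ?_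
    by_contra h
    refine hP.2 ((congrZeroMod_mul_iff P.2.2.prime (fun hdvd => h ?_) _).1 hP.1)
    exact natDegree_le_of_dvd hdvd ht0

theorem mainTheorem3 {F : Type u} [Field F] [Finite F] (S : Set (MonicIrreducible F)) :
    IsFrobenian S ↔
      ∃ (E : LinearRecurrence (RatFunc F)) (a : ℕ → RatFunc F),
        E.IsSolution a ∧ IsProdOfSeparable E.charPoly ∧
          S ⊆ zeroPrimes a ∧ (zeroPrimes a \ S).Finite := by
  constructor
  · rintro ⟨L, _, _, _, _, _, _, C, hC, hS⟩
    obtain ⟨E, a, ha, hE, hfin⟩ := exists_linearRecurrence_symmDiff_zeroPrimes_finite L hC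
    have hSa : (symmDiff S (zeroPrimes a)).Finite :=
      (hS.union (symmDiff_comm (zeroPrimes a) _ ▸ hfin)).subset (symmDiff_triangle _ _ _)
    obtain ⟨t, h₁, h₂, h₃⟩ := exists_mul_zeroPrimes a (T := S \ zeroPrimes a)
      (hSa.subset fun P hP => Or.inl hP)
    refine ⟨E, _, E.solSpace.smul_mem (algebraMap F[X] (RatFunc F) t) ha, hE, fun P hP => ?_, ?_⟩
    · by_cases h : P ∈ zeroPrimes a
      · exact h₂ h
      · exact h₁ ⟨hP, h⟩
    · refine (h₃.union (hSa.subset fun P hP => Or.inr hP)).subset fun P hP => ?_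
      by_cases h : P ∈ zeroPrimes a
      · exact Or.inr ⟨h, hP.2⟩
      · exact Or.inl ⟨hP.1, h⟩
  · rintro ⟨E, a, ha, hE, hS, hfin⟩
    refine isFrobenian_of_linearRecurrence ha hE (hfin.subset fun P hP => ?_)
    exact hP.elim (fun h => absurd (hS h.1) h.2) id
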